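/- Let $K$ be an imaginary quadratic field of discriminant $d_K$, other than $\mathbb{Q}(\sqrt{-1})$ and $\mathbb{Q}(\sqrt{-3})$, and let $N$ be a positive integer. Let $\mathcal{Q}(d_K)$ be the set of primitive positive definite binary quadratic forms $Q(x,y)=ax^2+bxy+cy^2$ over $\mathbb{Z}$ of discriminant $b^2-4ac=d_K$, and let $\mathcal{Q}_N(d_K)$ be the subset of those with $\gcd(N,a)=1$. For $\sigma\in\mathrm{SL}_2(\mathbb{Z})$ put $Q^\sigma=Q\left(\sigma\begin{bmatrix}x\\y\end{bmatrix}\right)$. Let $\mathrm{C}(d_K)$ be the set of classes of $\mathcal{Q}(d_K)$ under $Q\sim Q^\sigma$ ($\sigma\in\mathrm{SL}_2(\mathbb{Z})$), and let $\mathrm{C}_N(d_K)$ be the set of classes of $\mathcal{Q}_N(d_K)$ under the relation $Q'=Q^\sigma$ for some $\sigma\in\pm\Gamma_1(N)=\left\{\sigma\in\mathrm{SL}_2(\mathbb{Z}) : \sigma\equiv\pm\begin{bmatrix}1&*\\0&1\end{bmatrix}\pmod N\right\}$. A form in $\mathcal{Q}(d_K)$ is reduced if $|b|\le a\le c$, and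 $b\ge 0$ whenever $|b|=a$ or $a=c$. Let $\equiv_N$ be the equivalence relation on $\mathbb{Z}^2$ given by $(r,s)\equiv_N(u,v)\iff(r,s)\equiv\pm(u,v)\pmod N$. Then representatives of all classes of $\mathrm{C}_N(d_K)$ are listed explicitly, each class once, as follows. (i) There are only finitely many reduced forms $Q_1,\dots,Q_n$ in $\mathcal{Q}(d_K)$, and each class of $\mathrm{C}(d_K)$ contains exactly one of them. (ii) For each $i$ there is $\sigma_i\in\mathrm{SL}_2(\mathbb{Z})$ such that $Q_i'=Q_i^{\sigma_i}$ belongs to $\mathcal{Q}_N(d_K)$. (iii) Fix any such $\sigma_1,\dots,\sigma_n$. The set $I$ of pairs $(i,w)$, where $1\le i\le n$ and $w\in\mathbb{Z}^2/\equiv_N$ is the class of some $(u,v)$ with $\gcd(N,Q_i'(v,-u))=1$ (a condition depending only on $w$), is finite. For all $i$ and all $(u,v)\in\mathbb{Z}^2$ with $\gcd(N,Q_i'(v,-u))=1$ there is $\rho\in\mathrm{SL}_2(\mathbb{Z})$ with $\rho\equiv\begin{bmatrix}*&*\\u&v\end{bmatrix}\pmod N$. (iv) For each $(i,w)\in I$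 choose any $\rho_{i,w}\in\mathrm{SL}_2(\mathbb{Z})$ whose bottom row lies in the class $w$. Then each form $Q_i'\left(\rho_{i,w}^{-1}\begin{bmatrix}x\\y\end{bmatrix}\right)$ belongs to $\mathcal{Q}_N(d_K)$, and the map sending $(i,w)$ to the class of this form is a bijection from $I$ onto $\mathrm{C}_N(d_K)$. -/

import Mathlib

/-- The integral binary quadratic form `a x² + b x y + c y²`. -/
@[ext]
structure BinForm where
  a : ℤ
  b : ℤ
  c : ℤ

namespace BinForm

/-- The value `Q(x, y)`. -/
def eval (Q : BinForm) (x y : ℤ) : ℤ := Q.a * x ^ 2 + Q.b * x * y + Q.c * y ^ 2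

/-- The discriminant `b² - 4ac`. -/
def disc (Q : BinForm) : ℤ := Q.b ^ 2 - 4 * Q.a * Q.c

/-- The coefficients have no common factor. -/
def IsPrimitive (Q : BinForm) : Prop := Int.gcd (Int.gcd Q.a Q.b) Q.c = 1

/-- Positive definiteness. -/
def PosDef (Q : BinForm) : Prop := ∀ x y : ℤ, (x ≠ 0 ∨ y ≠ 0) → 0 < Q.eval x y

/-- The form `Q(σ (x, y)ᵗ)`, in coefficients; see `eval_act`. -/
def act (Q : BinForm) (σ : Matrix.SpecialLinearGroup (Fin 2) ℤ) : BinForm where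
  a := Q.eval (σ 0 0) (σ 1 0)
  b := 2 * Q.a * σ 0 0 * σ 0 1 + Q.b * (σ 0 0 * σ 1 1 + σ 0 1 * σ 1 0) + 2 * Q.c * σ 1 0 * σ 1 1
  c := Q.eval (σ 0 1) (σ 1 1)

theorem eval_act (Q : BinForm) (σ : Matrix.SpecialLinearGroup (Fin 2) ℤ) (x y : ℤ) :
    (Q.act σ).eval x y = Q.eval (σ 0 0 * x + σ 0 1 * y) (σ 1 0 * x + σ 1 1 * y) := by
  simp only [act, eval]
  ring

theorem act_one (Q : BinForm) : Q.act 1 = Q := by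
  ext <;> simp [act, eval]

theorem act_mul (Q : BinForm) (σ τ : Matrix.SpecialLinearGroup (Fin 2) ℤ) :
    Q.act (σ * τ) = (Q.act σ).act τ := by
  ext <;> simp [act, eval, Matrix.mul_apply, Fin.sum_univ_two] <;> ring

/-- A (primitive positive definite) form is reduced if `|b| ≤ a ≤ c`, and `b ≥ 0` whenever
`|b| = a` or `a = c`. -/
def IsReduced (Q : BinForm) : Prop :=
  |Q.b| ≤ Q.a ∧ Q.a ≤ Q.c ∧ ((|Q.b| = Q.a ∨ Q.a = Q.c) → 0 ≤ Q.b)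

end BinForm

/-- `𝒬(d)`: primitive positive definite forms of discriminant `d`. -/
def formsOfDisc (d : ℤ) : Set BinForm := {Q | Q.IsPrimitive ∧ Q.PosDef ∧ Q.disc = d}

/-- `𝒬_N(d)`: the forms in `𝒬(d)` whose leading coefficient is prime to `N`. -/
def formsOfLevel (N : ℕ) (d : ℤ) : Set BinForm := {Q | Q ∈ formsOfDisc d ∧ Int.gcd N Q.a = 1}

/-- The reduced forms in `𝒬(d)`. -/
def reducedForms (d : ℤ) : Set BinForm := {Q | Q ∈ formsOfDisc d ∧ Q.IsReduced}

/-- `±Γ₁(N)`. -/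
def pmGamma1 (N : ℕ) : Subgroup (Matrix.SpecialLinearGroup (Fin 2) ℤ) where
  carrier := {σ | σ ∈ CongruenceSubgroup.Gamma1 N ∨ -σ ∈ CongruenceSubgroup.Gamma1 N}
  one_mem' := Or.inl (one_mem _)
  mul_mem' := by
    rintro σ τ (hs | hs) (ht | ht)
    · exact Or.inl (mul_mem hs ht)
    · exact Or.inr (by simpa using mul_mem hs ht)
    · exact Or.inr (by simpa using mul_mem hs ht)
    · exact Or.inl (by simpa using mul_mem hs ht)
  inv_mem' := by
    rintro σ (hs | hs)
    · exact Or.inl (inv_mem hs)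
    · refine Or.inr ?_
      have h : (-σ)⁻¹ = -σ⁻¹ := by
        rw [inv_eq_iff_mul_eq_one]
        simp
      exact h ▸ inv_mem hs

/-- On a set `S` of forms, the relation "`Q' = Q(σ (x, y)ᵗ)` for some `σ ∈ Γ`". -/
def formSetoid (Γ : Subgroup (Matrix.SpecialLinearGroup (Fin 2) ℤ)) (S : Set BinForm) :
    Setoid S where
  r Q Q' := ∃ σ ∈ Γ, (Q' : BinForm) = (Q : BinForm).act σ
  iseqv :=
    { refl := fun Q => ⟨1, one_mem _, (Q : BinForm).act_one.symm⟩
      symm := by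
        rintro Q Q' ⟨σ, hs, h⟩
        exact ⟨σ⁻¹, inv_mem hs, by rw [h, ← BinForm.act_mul, mul_inv_cancel, BinForm.act_one]⟩
      trans := by
        rintro Q Q' Q'' ⟨σ, hs, h⟩ ⟨τ, ht, h'⟩
        exact ⟨σ * τ, mul_mem hs ht, by rw [h', h, BinForm.act_mul]⟩ }

/-- `C(d) = 𝒬(d)/∼`, the classes under proper equivalence. -/
abbrev FormClasses (d : ℤ) : Type := Quotient (formSetoid ⊤ (formsOfDisc d))

/-- `C_N(d) = 𝒬_N(d)/∼_N`, the classes under `±Γ₁(N)`. -/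
abbrev ExtFormClasses (N : ℕ) (d : ℤ) : Type :=
  Quotient (formSetoid (pmGamma1 N) (formsOfLevel N d))

/-- The relation `(r, s) ≡ ±(u, v) mod N` on `ℤ²`. -/
def pmModSetoid (N : ℕ) : Setoid (ℤ × ℤ) where
  r p q := (p.1 ≡ q.1 [ZMOD N] ∧ p.2 ≡ q.2 [ZMOD N]) ∨
    (p.1 ≡ -q.1 [ZMOD N] ∧ p.2 ≡ -q.2 [ZMOD N])
  iseqv :=
    { refl := fun p => Or.inl ⟨Int.ModEq.refl _, Int.ModEq.refl _⟩
      symm := by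
        rintro p q (⟨h1, h2⟩ | ⟨h1, h2⟩)
        · exact Or.inl ⟨h1.symm, h2.symm⟩
        · exact Or.inr ⟨by simpa using h1.symm.neg, by simpa using h2.symm.neg⟩
      trans := by
        rintro p q r (⟨h1, h2⟩ | ⟨h1, h2⟩) (⟨k1, k2⟩ | ⟨k1, k2⟩)
        · exact Or.inl ⟨h1.trans k1, h2.trans k2⟩
        · exact Or.inr ⟨h1.trans k1, h2.trans k2⟩
        · exact Or.inr ⟨h1.trans k1.neg, h2.trans k2.neg⟩
        · exact Or.inl ⟨by simpa using h1.trans k1.neg, by simpa using h2.trans k2.neg⟩ }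

/-- `ℤ²/±` modulo `N`. -/
abbrev PmVec (N : ℕ) : Type := Quotient (pmModSetoid N)

/-- The class of `(u, v)` in `ℤ²/±` modulo `N`. -/
def PmVec.mk (N : ℕ) (u v : ℤ) : PmVec N := Quotient.mk (pmModSetoid N) (u, v)

theorem BinForm.gcd_eval_congr (N : ℕ) (Q : BinForm) (p q : ℤ × ℤ)
    (h : (pmModSetoid N).r p q) :
    (Int.gcd N (Q.eval p.2 (-p.1)) = 1) = (Int.gcd N (Q.eval q.2 (-q.1)) = 1) := by
  have key : Q.eval p.2 (-p.1) ≡ Q.eval q.2 (-q.1) [ZMOD N] := by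
    rcases h with ⟨h1, h2⟩ | ⟨h1, h2⟩
    · exact (((h2.pow 2).mul_left _).add ((h2.mul_left _).mul h1.neg)).add
        ((h1.neg.pow 2).mul_left _)
    · have e : Q.eval q.2 (-q.1) = Q.eval (-q.2) (- -q.1) := by simp only [BinForm.eval]; ring
      rw [e]
      exact (((h2.pow 2).mul_left _).add ((h2.mul_left _).mul h1.neg)).add
        ((h1.neg.pow 2).mul_left _)
  have key2 : Int.gcd N (Q.eval p.2 (-p.1)) = Int.gcd N (Q.eval q.2 (-q.1)) := by
    rw [Int.gcd_comm, Int.gcd_comm (N : ℤ), ← Int.gcd_emod, key.eq, Int.gcd_emod]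
  rw [key2]

/-- The condition `gcd(N, Q(v, -u)) = 1` on the class of `(u, v)`. -/
def BinForm.Admissible (N : ℕ) (Q : BinForm) (w : PmVec N) : Prop :=
  Quotient.lift (s := pmModSetoid N)
    (fun p : ℤ × ℤ => Int.gcd N (Q.eval p.2 (-p.1)) = 1) (BinForm.gcd_eval_congr N Q) w

/-- Given `σ_Q ∈ SL₂(ℤ)` for the reduced forms `Q`, the pairs of a reduced form `Q` and a class
`w` of `(u, v)` in `ℤ²/±` modulo `N` with `gcd(N, Q'(v, -u)) = 1`, where `Q' = Q(σ_Q (x, y)ᵗ)`. -/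
def ListIndex (N : ℕ) (d : ℤ)
    (σ : reducedForms d → Matrix.SpecialLinearGroup (Fin 2) ℤ) : Type :=
  {p : reducedForms d × PmVec N // ((p.1 : BinForm).act (σ p.1)).Admissible N p.2}

/-!
A reduced form `Q` satisfies `c ≤ Q(x, y)` for all `y ≠ 0`. Hence a matrix of `SL₂(ℤ)` carrying one
reduced form to another is upper triangular or makes all their outer coefficients equal, and either
way the forms coincide. Conversely, a form of minimal leading coefficient in its orbit becomes
reduced after a translation and possibly an inversion.

A form of discriminant `d < -4` has no proper automorphisms besides `±1`: primitivity writes the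
entries of an automorphism in terms of a solution of `t² - d u² = 4`, and then `u = 0`. So, for a
fixed `Q'` in the class, the forms `Q'(ρ⁻¹ (x, y)ᵗ)` up to `±Γ₁(N)` correspond to the cosets
`±Γ₁(N) ρ`, that is, to the bottom rows of `ρ` modulo `N` up to sign, and the leading coefficient of
`Q'(ρ⁻¹ (x, y)ᵗ)` is `Q'(v, -u)` if `(u, v)` is the bottom row of `ρ`. A row `(u, v)` for which this
value is prime to `N` is unimodular modulo `N`, hence lifts to `SL₂(ℤ)`; that some such row exists
is the Chinese remainder theorem, as a primitive form does not vanish identically modulo a prime.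

If `K` is quadratic, then `d_K`, being the discriminant of a Galois extension, is a square in `K`;
so `d_K = -3` or `d_K = -4` would put `√-3` or `√-1` into `K`.
-/

open scoped MatrixGroups

theorem isSquare_algebraMap_discr {F L ι : Type*} [Field F] [Field L] [Algebra F L]
    [FiniteDimensional F L] [IsGalois F L] [Fintype ι] [DecidableEq ι] (b : Module.Basis ι F L) :
    IsSquare (algebraMap F L (Algebra.discr F b)) := by
  let e : ι ≃ Gal(L/F) := Fintype.equivOfCardEq <| by
    rw [← Nat.card_eq_fintype_card (α := Gal(L/F)), IsGalois.card_aut_eq_finrank,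
      Module.finrank_eq_card_basis b]
  let M : Matrix ι ι L := Matrix.of fun i j => e i (b j)
  have hM : (algebraMap F L).mapMatrix (Algebra.traceMatrix F b) = M.transpose * M := by
    ext i j
    simp [M, Matrix.mul_apply, Algebra.traceMatrix_apply, Algebra.traceForm_apply,
      trace_eq_sum_automorphisms, ← e.sum_comp]
  exact ⟨M.det, by
    rw [Algebra.discr_def, RingHom.map_det, hM, Matrix.det_mul, Matrix.det_transpose]⟩

theorem isSquare_discr_of_isGalois (K : Type*) [Field K] [NumberField K] [IsGalois ℚ K] :
    IsSquare (NumberField.discr K : K) := by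
  simpa [← NumberField.coe_discr] using
    isSquare_algebraMap_discr (NumberField.integralBasis K)

section QuadraticField

variable (K : Type*) [Field K] [NumberField K]

theorem isSquare_discr_of_finrank_eq_two (h : Module.finrank ℚ K = 2) :
    IsSquare (NumberField.discr K : K) :=
  have : Algebra.IsQuadraticExtension ℚ K := ⟨h⟩
  isSquare_discr_of_isGalois K

theorem discr_ne_neg_three (h : Module.finrank ℚ K = 2) (hK : ¬ ∃ x : K, x ^ 2 = -3) :
    NumberField.discr K ≠ -3 := fun hd =>
  let ⟨x, hx⟩ := isSquare_discr_of_finrank_eq_two K h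
  hK ⟨x, by rw [sq, ← hx, hd]; norm_num⟩

theorem discr_ne_neg_four (h : Module.finrank ℚ K = 2) (hK : ¬ ∃ x : K, x ^ 2 = -1) :
    NumberField.discr K ≠ -4 := fun hd =>
  let ⟨x, hx⟩ := isSquare_discr_of_finrank_eq_two K h
  hK ⟨x / 2, by rw [div_pow, sq x, ← hx, hd]; norm_num⟩

end QuadraticField

namespace BinForm

variable {Q R : BinForm} {σ τ : SL(2, ℤ)} {d : ℤ}

theorem act_act_inv (Q : BinForm) (σ : SL(2, ℤ)) : (Q.act σ).act σ⁻¹ = Q := by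
  rw [← act_mul, mul_inv_cancel, act_one]

theorem det_eq_one (σ : SL(2, ℤ)) : σ 0 0 * σ 1 1 - σ 0 1 * σ 1 0 = 1 := by
  rw [← Matrix.det_fin_two, σ.det_coe]

theorem disc_act (Q : BinForm) (σ : SL(2, ℤ)) : (Q.act σ).disc = Q.disc := calc
  (Q.act σ).disc = Q.disc * (σ 0 0 * σ 1 1 - σ 0 1 * σ 1 0) ^ 2 := by
    simp only [disc, act, eval]; ring
  _ = Q.disc := by rw [det_eq_one, one_pow, mul_one]

theorem PosDef.act (hQ : Q.PosDef) (σ : SL(2, ℤ)) : (Q.act σ).PosDef := by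
  intro x y hxy
  rw [eval_act]
  refine hQ _ _ ?_
  contrapose! hxy
  have hσ := det_eq_one σ
  constructor
  · linear_combination σ 1 1 * hxy.1 - σ 0 1 * hxy.2 - x * hσ
  · linear_combination σ 0 0 * hxy.2 - σ 1 0 * hxy.1 - y * hσ

theorem PosDef.a_pos (hQ : Q.PosDef) : 0 < Q.a := by
  simpa [eval] using hQ 1 0 (Or.inl one_ne_zero)

theorem PosDef.disc_neg (hQ : Q.PosDef) : Q.disc < 0 := by
  have ha := hQ.a_pos
  have h : Q.eval Q.b (-2 * Q.a) = Q.a * -Q.disc := by simp only [eval, disc]; ring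
  have hpos : 0 < Q.a * -Q.disc := h ▸ hQ Q.b (-2 * Q.a) (Or.inr (by lia))
  exact neg_pos.1 (pos_of_mul_pos_right hpos ha.le)

theorem isPrimitive_iff_isUnit :
    Q.IsPrimitive ↔ ∀ k : ℤ, k ∣ Q.a → k ∣ Q.b → k ∣ Q.c → IsUnit k := by
  constructor
  · intro h k ha hb hc
    have hk : k ∣ (Int.gcd (Int.gcd Q.a Q.b) Q.c : ℤ) :=
      Int.dvd_coe_gcd (Int.dvd_coe_gcd ha hb) hc
    rw [IsPrimitive] at h
    rw [h] at hk
    exact isUnit_of_dvd_one (by exact_mod_cast hk)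
  · intro h
    have hab : (Int.gcd (Int.gcd Q.a Q.b) Q.c : ℤ) ∣ Int.gcd Q.a Q.b := Int.gcd_dvd_left ..
    simpa using! Int.isUnit_iff_natAbs_eq.1 <| h _ (hab.trans (Int.gcd_dvd_left ..))
      (hab.trans (Int.gcd_dvd_right ..)) (Int.gcd_dvd_right ..)

theorem IsPrimitive.exists_bezout (hQ : Q.IsPrimitive) :
    ∃ x y z : ℤ, x * Q.a + y * Q.b + z * Q.c = 1 := by
  have hab := Int.gcd_eq_gcd_ab Q.a Q.b
  have habc := Int.gcd_eq_gcd_ab (Int.gcd Q.a Q.b) Q.c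
  rw [IsPrimitive] at hQ
  rw [hQ] at habc
  set x := Int.gcdA (Int.gcd Q.a Q.b) Q.c
  refine ⟨Int.gcdA Q.a Q.b * x, Int.gcdB Q.a Q.b * x, Int.gcdB (Int.gcd Q.a Q.b) Q.c, ?_⟩
  push_cast at habc
  linear_combination -habc - x * hab

theorem dvd_coeff_act {k : ℤ} (ha : k ∣ Q.a) (hb : k ∣ Q.b) (hc : k ∣ Q.c) (σ : SL(2, ℤ)) :
    k ∣ (Q.act σ).a ∧ k ∣ (Q.act σ).b ∧ k ∣ (Q.act σ).c := by
  have dvd_eval (x y : ℤ) : k ∣ Q.eval x y :=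
    dvd_add (dvd_add (ha.mul_right _) ((hb.mul_right _).mul_right _)) (hc.mul_right _)
  refine ⟨dvd_eval _ _, dvd_add (dvd_add ?_ (hb.mul_right _)) ?_, dvd_eval _ _⟩
  · exact ((ha.mul_left 2).mul_right _).mul_right _
  · exact ((hc.mul_left 2).mul_right _).mul_right _

theorem IsPrimitive.act (hQ : Q.IsPrimitive) (σ : SL(2, ℤ)) : (Q.act σ).IsPrimitive := by
  rw [isPrimitive_iff_isUnit] at hQ ⊢
  intro k ha hb hc
  obtain ⟨ha', hb', hc'⟩ := dvd_coeff_act ha hb hc σ⁻¹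
  rw [act_act_inv] at ha' hb' hc'
  exact hQ k ha' hb' hc'

theorem act_mem_formsOfDisc (hQ : Q ∈ formsOfDisc d) (σ : SL(2, ℤ)) : Q.act σ ∈ formsOfDisc d :=
  ⟨hQ.1.act σ, hQ.2.1.act σ, (disc_act Q σ).trans hQ.2.2⟩

/-! ### Proper automorphisms -/

theorem disc_le_neg_five (hQ : Q ∈ formsOfDisc d) (h3 : d ≠ -3) (h4 : d ≠ -4) :
    Q.disc ≤ -5 := by
  have hneg := hQ.2.1.disc_neg
  rw [← hQ.2.2] at h3 h4
  have hb : Q.b ^ 2 % 4 = 0 ∨ Q.b ^ 2 % 4 = 1 := by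
    obtain ⟨k, hk⟩ | hodd := Int.even_or_odd Q.b
    · exact Or.inl (Int.emod_eq_zero_of_dvd ⟨k ^ 2, by rw [hk]; ring⟩)
    · exact Or.inr (Int.sq_mod_four_eq_one_of_odd hodd)
  have hdisc : Q.disc = Q.b ^ 2 - 4 * (Q.a * Q.c) := by rw [disc]; ring
  lia

/-- The vector `(r, s - p, -q)` attached to an automorphism `(p, q; r, s)` is proportional to the
coefficient vector, which is primitive. -/
theorem IsPrimitive.exists_eq_mul_of_act_eq (hQ : Q.IsPrimitive) (h : Q.act σ = Q) :
    ∃ u, σ 1 0 = Q.a * u ∧ σ 1 1 - σ 0 0 = Q.b * u ∧ -σ 0 1 = Q.c * u := by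
  obtain ⟨x, y, z, hxyz⟩ := hQ.exists_bezout
  have hσ := det_eq_one σ
  have ha := congrArg BinForm.a h
  have hb := congrArg BinForm.b h
  have hc := congrArg BinForm.c h
  simp only [BinForm.act, eval] at ha hb hc
  set p := σ 0 0
  set q := σ 0 1
  set r := σ 1 0
  set s := σ 1 1
  have hab : Q.b * r = Q.a * (s - p) := mul_left_cancel₀ two_ne_zero <| by
    linear_combination 2 * s * ha - r * hb - (2 * Q.a * p + Q.b * r) * hσ
  have hac : Q.a * q = -(Q.c * r) := mul_left_cancel₀ two_ne_zero <| by
    linear_combination s * hb - 2 * r * hc - (2 * Q.a * q + Q.b * s) * hσ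
  have hbc : Q.b * q = Q.c * (p - s) := mul_left_cancel₀ two_ne_zero <| by
    linear_combination 2 * p * hc - q * hb - (2 * Q.c * s + Q.b * q) * hσ
  refine ⟨x * r + y * (s - p) - z * q, ?_, ?_, ?_⟩
  · linear_combination -r * hxyz + y * hab + z * hac
  · linear_combination -(s - p) * hxyz - x * hab + z * hbc
  · linear_combination q * hxyz - x * hac - y * hbc

theorem eq_one_or_eq_neg_one_of_act_eq (hQ : Q.IsPrimitive) (hdisc : Q.disc ≤ -5)
    (h : Q.act σ = Q) : σ = 1 ∨ σ = -1 := by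
  obtain ⟨u, hr, hps, hq⟩ := hQ.exists_eq_mul_of_act_eq h
  have hσ := det_eq_one σ
  have pell : (σ 0 0 + σ 1 1) ^ 2 - 4 = u ^ 2 * Q.disc := by
    rw [disc]
    linear_combination (σ 1 1 - σ 0 0 + Q.b * u) * hps + 4 * hσ + 4 * σ 0 1 * hr
      - 4 * Q.a * u * hq
  have hu : u = 0 := by
    by_contra hu
    nlinarith [sq_nonneg (σ 0 0 + σ 1 1), Int.one_le_abs hu, sq_abs u]
  simp only [hu, mul_zero, neg_eq_zero, sub_eq_zero] at hr hps hq
  have hs : σ 0 0 ^ 2 = 1 := by linear_combination hσ + σ 0 1 * hr - σ 0 0 * hps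
  refine (sq_eq_one_iff.1 hs).imp (fun h => ?_) fun h => ?_ <;>
  · ext i j
    fin_cases i <;> fin_cases j <;> simp [hr, hps, hq, h]

theorem eq_or_eq_neg_of_act_eq_act (hQ : Q.IsPrimitive) (hdisc : Q.disc ≤ -5)
    (h : Q.act σ = Q.act τ) : σ = τ ∨ σ = -τ := by
  have hfix : Q.act (σ * τ⁻¹) = Q := by rw [act_mul, h, act_act_inv]
  refine (eq_one_or_eq_neg_one_of_act_eq hQ hdisc hfix).imp mul_inv_eq_one.1 fun h => ?_
  rw [mul_inv_eq_iff_eq_mul.1 h, neg_one_mul]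

/-! ### Reduction theory -/

theorem IsReduced.c_le_eval (h : Q.IsReduced) (x : ℤ) {y : ℤ} (hy : y ≠ 0) :
    Q.c ≤ Q.eval x y := by
  obtain ⟨hba, hac, -⟩ := h
  have ha : 0 ≤ Q.a := (abs_nonneg _).trans hba
  have hy2 : 1 ≤ y ^ 2 := Int.add_one_le_iff.2 (sq_pos_of_ne_zero hy)
  have hnorm : 1 ≤ x ^ 2 - |x * y| + y ^ 2 := by
    rcases abs_cases (x * y) with ⟨e, -⟩ | ⟨e, -⟩ <;> rw [e] <;>
      nlinarith [sq_nonneg (2 * x - y), sq_nonneg (2 * x + y)]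
  have hb : -(Q.a * |x * y|) ≤ Q.b * (x * y) := calc
    -(Q.a * |x * y|) ≤ -(|Q.b| * |x * y|) := by gcongr
    _ ≤ Q.b * (x * y) := by rw [← abs_mul]; exact neg_abs_le _
  calc Q.c ≤ Q.c + Q.a * (x ^ 2 - |x * y| + y ^ 2 - 1) + (Q.c - Q.a) * (y ^ 2 - 1) := by
        nlinarith [mul_nonneg ha (sub_nonneg.2 hnorm),
          mul_nonneg (sub_nonneg.2 hac) (sub_nonneg.2 hy2)]
    _ ≤ Q.eval x y := by rw [eval]; linarith

theorem ext_of_disc_eq (h0 : R.a ≠ 0) (ha : Q.a = R.a) (hb : Q.b = R.b)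
    (hd : Q.disc = R.disc) : Q = R := by
  refine BinForm.ext ha hb (mul_left_cancel₀ (mul_ne_zero four_ne_zero h0) ?_)
  rw [disc, disc, ha, hb] at hd
  exact sub_right_injective hd

theorem IsReduced.b_mem_Ioc (h : Q.IsReduced) (ha : 0 < Q.a) : Q.b ∈ Set.Ioc (-Q.a) Q.a := by
  obtain ⟨hba, -, hsign⟩ := h
  grind

theorem IsReduced.act_eq_of_apply_one_zero_eq_zero (h : Q.IsReduced) (ha : 0 < Q.a)
    (h' : (Q.act σ).IsReduced) (hr : σ 1 0 = 0) : Q.act σ = Q := by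
  have hps : σ 0 0 * σ 1 1 = 1 := by simpa [hr] using det_eq_one σ
  have hp : σ 0 0 ^ 2 = 1 := by
    rcases Int.eq_one_or_neg_one_of_mul_eq_one hps with e | e <;> simp [e]
  have ha' : (Q.act σ).a = Q.a := by simp [act, eval, hr, hp]
  have hb' : (Q.act σ).b = Q.b + 2 * Q.a * (σ 0 0 * σ 0 1) := by
    simp only [act, hr]
    linear_combination Q.b * hps
  have hb := h.b_mem_Ioc ha
  have hmem := h'.b_mem_Ioc (ha'.symm ▸ ha)
  rw [ha', hb'] at hmem
  have hq : σ 0 0 * σ 0 1 = 0 := by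
    have hlt : σ 0 0 * σ 0 1 < 1 := by nlinarith [hb.1, hmem.2]
    have hgt : -1 < σ 0 0 * σ 0 1 := by nlinarith [hb.2, hmem.1]
    lia
  have hb'' : (Q.act σ).b = Q.b := by rw [hb', hq, mul_zero, add_zero]
  exact ext_of_disc_eq ha.ne' ha' hb'' (disc_act Q σ)

theorem IsReduced.act_eq_of_apply_one_zero_ne_zero (h : Q.IsReduced) (h' : (Q.act σ).IsReduced)
    (hr : σ 1 0 ≠ 0) : Q.act σ = Q := by
  have hca : Q.c ≤ (Q.act σ).a := h.c_le_eval _ hr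
  have hca' : (Q.act σ).c ≤ Q.a := by
    have hr' : σ⁻¹ 1 0 ≠ 0 := by simpa [Matrix.adjugate_fin_two] using hr
    have hle : (Q.act σ).c ≤ ((Q.act σ).act σ⁻¹).a := h'.c_le_eval _ hr'
    rwa [act_act_inv] at hle
  obtain ⟨-, hac, hsign⟩ := h
  obtain ⟨-, hac', hsign'⟩ := h'
  have ha : (Q.act σ).a = Q.a := by lia
  have hc : (Q.act σ).c = Q.c := by lia
  have hb : 0 ≤ Q.b := hsign (Or.inr (by lia))
  have hb' : 0 ≤ (Q.act σ).b := hsign' (Or.inr (by lia))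
  have hb2 : (Q.act σ).b ^ 2 = Q.b ^ 2 := by
    have hdisc := disc_act Q σ
    rw [disc, disc, ha, hc] at hdisc
    exact sub_left_injective hdisc
  exact BinForm.ext ha ((sq_eq_sq₀ hb' hb).1 hb2) hc

theorem IsReduced.eq_of_act_eq_act (hQ : Q.IsReduced) (ha : 0 < Q.a) (hR : R.IsReduced)
    (h : Q.act σ = R.act τ) : Q = R := by
  obtain rfl : Q.act (σ * τ⁻¹) = R := by rw [act_mul, h, act_act_inv]
  by_cases hr : (σ * τ⁻¹) 1 0 = 0
  · exact (hQ.act_eq_of_apply_one_zero_eq_zero ha hR hr).symm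
  · exact (hQ.act_eq_of_apply_one_zero_ne_zero hR hr).symm

theorem act_S (Q : BinForm) : Q.act ModularGroup.S = ⟨Q.c, -Q.b, Q.a⟩ := by
  ext <;> simp [act, eval, ModularGroup.coe_S]

theorem act_T_zpow (Q : BinForm) (n : ℤ) :
    Q.act (ModularGroup.T ^ n) = ⟨Q.a, Q.b + 2 * Q.a * n, Q.eval n 1⟩ := by
  ext <;> simp [act, eval, ModularGroup.coe_T_zpow, add_comm]

theorem isReduced_or_isReduced_act_S (hb : Q.b ∈ Set.Ioc (-Q.a) Q.a) (hac : Q.a ≤ Q.c) :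
    Q.IsReduced ∨ (Q.act ModularGroup.S).IsReduced := by
  have hba : |Q.b| ≤ Q.a := abs_le.2 ⟨hb.1.le, hb.2⟩
  by_cases hsign : Q.a = Q.c ∧ Q.b < 0
  · rw [act_S]
    exact Or.inr ⟨by simpa [← hsign.1] using hba, hsign.1.ge, fun _ => by simpa using hsign.2.le⟩
  · refine Or.inl ⟨hba, hac, ?_⟩
    rintro (e | e) <;> grind

theorem PosDef.exists_act_a_le (hQ : Q.PosDef) : ∃ σ, ∀ τ, (Q.act σ).a ≤ (Q.act τ).a := by
  let f : SL(2, ℤ) → ℕ := fun τ => (Q.act τ).a.toNat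
  refine ⟨Function.argmin f, fun τ => ?_⟩
  exact (Int.toNat_le.1 (Function.argmin_le f τ)).trans_eq
    (Int.toNat_of_nonneg (hQ.act τ).a_pos.le)

theorem PosDef.exists_isReduced_act (hQ : Q.PosDef) : ∃ σ, (Q.act σ).IsReduced := by
  obtain ⟨σ, hmin⟩ := hQ.exists_act_a_le
  have ha := (hQ.act σ).a_pos
  obtain ⟨n, hn, -⟩ := existsUnique_add_zsmul_mem_Ioc (a := 2 * (Q.act σ).a) (by lia)
    (Q.act σ).b (-(Q.act σ).a)
  let R := Q.act (σ * ModularGroup.T ^ n)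
  have hR : R = ⟨(Q.act σ).a, (Q.act σ).b + 2 * (Q.act σ).a * n, (Q.act σ).eval n 1⟩ := by
    rw [← act_T_zpow, ← act_mul]
  have hb : R.b ∈ Set.Ioc (-R.a) R.a := by
    convert hn using 2 <;> simp only [hR, smul_eq_mul] <;> ring
  have hac : R.a ≤ R.c := by
    have hle := hmin (σ * ModularGroup.T ^ n * ModularGroup.S)
    rw [act_mul, act_S] at hle
    exact (congrArg BinForm.a hR).trans_le hle
  rcases isReduced_or_isReduced_act_S hb hac with h | h
  · exact ⟨_, h⟩
  · exact ⟨σ * ModularGroup.T ^ n * ModularGroup.S, by rwa [act_mul]⟩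

theorem IsReduced.coeff_mem_Icc (h : Q.IsReduced) (ha : 0 < Q.a) :
    Q.a ∈ Set.Icc Q.disc (-Q.disc) ∧ Q.b ∈ Set.Icc Q.disc (-Q.disc) ∧
      Q.c ∈ Set.Icc Q.disc (-Q.disc) := by
  obtain ⟨hba, hac, -⟩ := h
  have hb := abs_le.1 hba
  have hc : Q.c ≤ -Q.disc := by
    have hb2 : Q.b ^ 2 ≤ Q.a ^ 2 := sq_le_sq' hb.1 hb.2
    rw [disc]
    nlinarith
  simp only [Set.mem_Icc]
  lia

end BinForm

theorem finite_reducedForms (d : ℤ) : (reducedForms d).Finite := by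
  let I := Set.Icc d (-d)
  have hI : I.Finite := Set.finite_Icc _ _
  refine ((hI.prod (hI.prod hI)).image fun p => BinForm.mk p.1 p.2.1 p.2.2).subset ?_
  rintro Q ⟨⟨-, hQ, rfl⟩, hred⟩
  exact ⟨(Q.a, Q.b, Q.c), hred.coeff_mem_Icc hQ.a_pos, rfl⟩

theorem bijective_reducedForms (d : ℤ) : Function.Bijective (fun Q : reducedForms d =>
    (Quotient.mk (formSetoid ⊤ (formsOfDisc d)) ⟨Q.1, Q.2.1⟩ : FormClasses d)) := by
  constructor
  · intro Q R h
    obtain ⟨σ, -, hσ⟩ := Quotient.exact h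
    exact Subtype.ext <| Q.2.2.eq_of_act_eq_act (τ := 1) Q.2.1.2.1.a_pos R.2.2 <|
      hσ.symm.trans R.1.act_one.symm
  · rintro ⟨Q, hQ⟩
    obtain ⟨σ, hσ⟩ := hQ.2.1.exists_isReduced_act
    exact ⟨⟨Q.act σ, BinForm.act_mem_formsOfDisc hQ σ, hσ⟩,
      Quotient.sound ⟨σ⁻¹, trivial, (Q.act_act_inv σ).symm⟩⟩

/-! ### Unimodular rows modulo `N` -/

theorem exists_isCoprime_add_mul {u v n : ℤ} (hu : u ≠ 0) (h : IsCoprime (Int.gcd u n : ℤ) v) :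
    ∃ t, IsCoprime u (v + t * n) := by
  have : NeZero u.natAbs := ⟨Int.natAbs_ne_zero.2 hu⟩
  have hgu : Int.gcd u n ∣ u.natAbs := Int.natCast_dvd.1 (Int.gcd_dvd_left ..)
  have hv : IsUnit (v : ZMod (Int.gcd u n)) :=
    (ZMod.coe_int_isUnit_iff_isCoprime _ _).2 h
  obtain ⟨x, hx⟩ := ZMod.unitsMap_surjective hgu hv.unit
  obtain ⟨w, hw⟩ := ZMod.intCast_surjective (x : ZMod u.natAbs)
  have hwu : IsCoprime u w := by
    simpa [IsCoprime.abs_left_iff] using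
      (ZMod.coe_int_isUnit_iff_isCoprime w u.natAbs).1 (hw ▸ x.isUnit)
  have hwv : (v : ZMod (Int.gcd u n)) = w := by
    have hx' := congrArg Units.val hx
    rw [ZMod.unitsMap_val, ← hw, ZMod.cast_intCast hgu] at hx'
    exact hx'.symm
  obtain ⟨k, hk⟩ := (ZMod.intCast_eq_intCast_iff_dvd_sub _ _ _).1 hwv
  refine ⟨Int.gcdB u n * k, ?_⟩
  have hsum : v + Int.gcdB u n * k * n = w + u * -(Int.gcdA u n * k) := by
    linear_combination -hk - k * Int.gcd_eq_gcd_ab u n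
  rw [hsum]
  exact hwu.add_mul_left_right _

theorem exists_SL2_bottom_row_modEq {u v n : ℤ} (hn : n ≠ 0)
    (h : IsCoprime (Int.gcd u n : ℤ) v) :
    ∃ ρ : SL(2, ℤ), ρ 1 0 ≡ u [ZMOD n] ∧ ρ 1 1 ≡ v [ZMOD n] := by
  wlog hu : u ≠ 0 generalizing u
  · obtain ⟨ρ, h0, h1⟩ := this (u := u + n) (by simpa using h) (by lia)
    exact ⟨ρ, h0.trans (by simp), h1⟩
  obtain ⟨t, ht⟩ := exists_isCoprime_add_mul hu h
  obtain ⟨ρ, h0, h1⟩ := ht.exists_SL2_row 1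
  exact ⟨ρ, h0 ▸ Int.ModEq.rfl, h1 ▸ by simp⟩

theorem BinForm.isCoprime_gcd_of_gcd_eval {Q : BinForm} {N u v : ℤ}
    (h : Int.gcd N (Q.eval v (-u)) = 1) : IsCoprime (Int.gcd u N : ℤ) v := by
  have hN : IsCoprime (Int.gcd u N : ℤ) (Q.eval v (-u)) :=
    (Int.isCoprime_iff_gcd_eq_one.2 h).of_isCoprime_of_dvd_left (Int.gcd_dvd_right ..)
  obtain ⟨k, hk⟩ : (Int.gcd u N : ℤ) ∣ u := Int.gcd_dvd_left ..
  have heval : Q.eval v (-u) =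
      v * (Q.a * v - Q.b * u) + (Int.gcd u N : ℤ) * (k * u * Q.c) := by
    rw [eval]
    linear_combination Q.c * u * hk
  rw [heval, IsCoprime.add_mul_left_right_iff] at hN
  exact hN.of_mul_right_left

/-- The bottom row of `ρ` in `ℤ²/±` modulo `N`; it classifies the cosets `±Γ₁(N) ρ`. -/
def bottomRow (N : ℕ) (ρ : SL(2, ℤ)) : PmVec N := PmVec.mk N (ρ 1 0) (ρ 1 1)

section bottomRow

variable {N : ℕ} {ρ τ : SL(2, ℤ)}

theorem PmVec.mk_eq_mk_iff {r s u v : ℤ} : PmVec.mk N r s = PmVec.mk N u v ↔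
    ((r : ZMod N) = u ∧ (s : ZMod N) = v) ∨ ((r : ZMod N) = -u ∧ (s : ZMod N) = -v) := by
  simp only [← Int.cast_neg, ZMod.intCast_eq_intCast_iff]
  exact Quotient.eq

theorem bottomRow_neg : bottomRow N (-ρ) = bottomRow N ρ :=
  PmVec.mk_eq_mk_iff.2 (Or.inr (by simp))

theorem bottomRow_mul_right (h : bottomRow N ρ = bottomRow N τ) (α : SL(2, ℤ)) :
    bottomRow N (ρ * α) = bottomRow N (τ * α) := by
  simp only [bottomRow, PmVec.mk_eq_mk_iff, Matrix.SpecialLinearGroup.coe_mul, Matrix.mul_apply,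
    Fin.sum_univ_two, Int.cast_add, Int.cast_mul] at h ⊢
  refine h.imp ?_ ?_ <;> rintro ⟨h0, h1⟩ <;> rw [h0, h1] <;> constructor <;> ring

theorem mem_pmGamma1_iff : ρ ∈ pmGamma1 N ↔ bottomRow N ρ = bottomRow N 1 := by
  have mem_Gamma1 (σ : SL(2, ℤ)) : σ ∈ CongruenceSubgroup.Gamma1 N ↔
      (σ 1 0 : ZMod N) = 0 ∧ (σ 1 1 : ZMod N) = 1 := by
    have hdet := congrArg (Int.cast : ℤ → ZMod N) (BinForm.det_eq_one σ)
    push_cast at hdet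
    grind [CongruenceSubgroup.Gamma1_mem]
  have mem_iff : ρ ∈ pmGamma1 N ↔
      ρ ∈ CongruenceSubgroup.Gamma1 N ∨ -ρ ∈ CongruenceSubgroup.Gamma1 N := Iff.rfl
  rw [mem_iff, mem_Gamma1, mem_Gamma1, bottomRow, bottomRow, PmVec.mk_eq_mk_iff]
  simp [neg_eq_iff_eq_neg]

theorem mul_inv_mem_pmGamma1_iff : ρ * τ⁻¹ ∈ pmGamma1 N ↔ bottomRow N ρ = bottomRow N τ := by
  rw [mem_pmGamma1_iff]
  constructor <;> intro h
  · simpa using bottomRow_mul_right h τ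
  · simpa using bottomRow_mul_right h τ⁻¹

theorem finite_pmVec (hN : 0 < N) : Finite (PmVec N) := by
  have : NeZero N := ⟨hN.ne'⟩
  refine Finite.of_surjective
    (fun p : ZMod N × ZMod N => PmVec.mk N (p.1.val : ℤ) (p.2.val : ℤ)) ?_
  rintro ⟨u, v⟩
  exact ⟨((u : ZMod N), (v : ZMod N)), PmVec.mk_eq_mk_iff.2 (Or.inl (by simp))⟩

end bottomRow

/-! ### Forms whose leading coefficient is prime to `N` -/

namespace BinForm

variable {Q : BinForm} {N : ℕ} {d : ℤ} {ρ σ τ : SL(2, ℤ)}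

theorem IsPrimitive.exists_not_dvd_eval (hQ : Q.IsPrimitive) {p : ℕ} (hp : p ≠ 1) :
    ∃ z : ℕ × ℕ, ¬ (p : ℤ) ∣ Q.eval z.1 z.2 := by
  by_contra! h
  have ha : (p : ℤ) ∣ Q.a := by simpa [eval] using h (1, 0)
  have hc : (p : ℤ) ∣ Q.c := by simpa [eval] using h (0, 1)
  have hb : (p : ℤ) ∣ Q.b := by
    have habc : (p : ℤ) ∣ Q.a + Q.b + Q.c := by simpa [eval] using h (1, 1)
    exact (dvd_add_right ha).1 ((dvd_add_left hc).1 habc)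
  exact hp (by simpa [Int.ofNat_isUnit] using isPrimitive_iff_isUnit.1 hQ p ha hb hc)

theorem eval_modEq (Q : BinForm) {n x y x' y' : ℤ} (hx : x ≡ x' [ZMOD n])
    (hy : y ≡ y' [ZMOD n]) : Q.eval x y ≡ Q.eval x' y' [ZMOD n] :=
  (((hx.pow 2).mul_left _).add ((hx.mul_left _).mul hy)).add ((hy.pow 2).mul_left _)

theorem IsPrimitive.exists_gcd_eval_eq_one (hQ : Q.IsPrimitive) (hN : N ≠ 0) :
    ∃ x y : ℤ, Int.gcd N (Q.eval x y) = 1 := by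
  choose! f hf using fun (p : ℕ) (hp : p ≠ 1) => hQ.exists_not_dvd_eval hp
  have crt (g : ℕ → ℕ) : ∃ k : ℕ, ∀ p ∈ N.primeFactors, k ≡ g p [MOD p] :=
    ⟨_, (Nat.chineseRemainderOfFinset g id N.primeFactors
      (fun p hp => (Nat.prime_of_mem_primeFactors hp).ne_zero)
      fun p hp q hq hpq => (Nat.coprime_primes (Nat.prime_of_mem_primeFactors hp)
        (Nat.prime_of_mem_primeFactors hq)).2 hpq).2⟩
  obtain ⟨x, hx⟩ := crt fun p => (f p).1
  obtain ⟨y, hy⟩ := crt fun p => (f p).2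
  refine ⟨x, y, ?_⟩
  by_contra hne
  obtain ⟨p, hp, hpd⟩ := Nat.exists_prime_and_dvd hne
  have hpN : p ∈ N.primeFactors :=
    Nat.mem_primeFactors.2 ⟨hp, by simpa using hpd.trans (Int.gcd_dvd_natAbs_left ..), hN⟩
  have hpQ : (p : ℤ) ∣ Q.eval x y := Int.natCast_dvd.2 (hpd.trans (Int.gcd_dvd_natAbs_right ..))
  have hmod : Q.eval x y ≡ Q.eval (f p).1 (f p).2 [ZMOD p] :=
    Q.eval_modEq (Int.natCast_modEq_iff.2 (hx p hpN)) (Int.natCast_modEq_iff.2 (hy p hpN))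
  exact hf p hp.ne_one (hmod.dvd_iff.1 hpQ)

theorem act_inv_mem_formsOfLevel_iff (hQ : Q ∈ formsOfDisc d) :
    Q.act ρ⁻¹ ∈ formsOfLevel N d ↔ Q.Admissible N (bottomRow N ρ) := by
  have ha : (Q.act ρ⁻¹).a = Q.eval (ρ 1 1) (-ρ 1 0) := by
    simp [act, Matrix.adjugate_fin_two]
  have hadm : Q.Admissible N (bottomRow N ρ) ↔ Int.gcd N (Q.eval (ρ 1 1) (-ρ 1 0)) = 1 := Iff.rfl
  rw [hadm, ← ha]
  exact and_iff_right (act_mem_formsOfDisc hQ _)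

theorem exists_act_mem_formsOfLevel (hQ : Q ∈ formsOfDisc d) (hN : N ≠ 0) :
    ∃ σ, Q.act σ ∈ formsOfLevel N d := by
  obtain ⟨x, y, hxy⟩ := hQ.1.exists_gcd_eval_eq_one hN
  have hgcd : Int.gcd N (Q.eval x (- -y)) = 1 := by rwa [neg_neg]
  obtain ⟨ρ, h0, h1⟩ :=
    exists_SL2_bottom_row_modEq (Int.natCast_ne_zero.2 hN) (isCoprime_gcd_of_gcd_eval hgcd)
  have hrow : bottomRow N ρ = PmVec.mk N (-y) x := Quotient.sound (Or.inl ⟨h0, h1⟩)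
  exact ⟨ρ⁻¹, (act_inv_mem_formsOfLevel_iff hQ).2 (hrow ▸ hgcd)⟩

theorem bottomRow_eq_of_act_inv_eq_act (hQ : Q.IsPrimitive) (hdisc : Q.disc ≤ -5)
    (hσ : σ ∈ pmGamma1 N) (h : Q.act τ⁻¹ = (Q.act ρ⁻¹).act σ) :
    bottomRow N ρ = bottomRow N τ := by
  rw [← mul_inv_mem_pmGamma1_iff, mem_pmGamma1_iff]
  rw [mem_pmGamma1_iff] at hσ
  rw [← act_mul] at h
  rcases eq_or_eq_neg_of_act_eq_act hQ hdisc h.symm with h | h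
  · rwa [inv_mul_eq_iff_eq_mul.1 h] at hσ
  · rwa [inv_mul_eq_iff_eq_mul.1 h, mul_neg, bottomRow_neg] at hσ

end BinForm

section ListIndex

variable {N : ℕ} {d : ℤ} {σ : reducedForms d → SL(2, ℤ)} {ρ : ListIndex N d σ → SL(2, ℤ)}

/-- The map of part (iv): `(Q, w)` goes to the class in `C_N(d)` of `Q'(ρ⁻¹ (x, y)ᵗ)`, where `ρ` is
the matrix chosen for `(Q, w)`. -/
def listClass (hmem : ∀ p : ListIndex N d σ,
    ((p.1.1 : BinForm).act (σ p.1.1)).act (ρ p)⁻¹ ∈ formsOfLevel N d)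
    (p : ListIndex N d σ) : ExtFormClasses N d :=
  Quotient.mk _ ⟨_, hmem p⟩

theorem injective_listClass (h3 : d ≠ -3) (h4 : d ≠ -4)
    (hρ : ∀ p : ListIndex N d σ, bottomRow N (ρ p) = p.1.2)
    (hmem : ∀ p : ListIndex N d σ,
      ((p.1.1 : BinForm).act (σ p.1.1)).act (ρ p)⁻¹ ∈ formsOfLevel N d) :
    Function.Injective (listClass hmem) := by
  rintro p q hpq
  obtain ⟨γ, hγ, h⟩ := Quotient.exact hpq
  change (q.1.1.1.act (σ q.1.1)).act (ρ q)⁻¹ = ((p.1.1.1.act (σ p.1.1)).act (ρ p)⁻¹).act γ at h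
  have hform : p.1.1 = q.1.1 := by
    refine Subtype.ext (p.1.1.2.2.eq_of_act_eq_act (σ := σ p.1.1 * (ρ p)⁻¹ * γ)
      (τ := σ q.1.1 * (ρ q)⁻¹) p.1.1.2.1.2.1.a_pos q.1.1.2.2 ?_)
    rw [BinForm.act_mul, BinForm.act_mul, BinForm.act_mul, h]
  refine Subtype.ext (Prod.ext hform ?_)
  rw [← hform] at h
  have hQ := BinForm.act_mem_formsOfDisc p.1.1.2.1 (σ p.1.1)
  rw [← hρ, ← hρ]
  exact BinForm.bottomRow_eq_of_act_inv_eq_act hQ.1 (BinForm.disc_le_neg_five hQ h3 h4)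
    hγ h

theorem surjective_listClass (hρ : ∀ p : ListIndex N d σ, bottomRow N (ρ p) = p.1.2)
    (hmem : ∀ p : ListIndex N d σ,
      ((p.1.1 : BinForm).act (σ p.1.1)).act (ρ p)⁻¹ ∈ formsOfLevel N d) :
    Function.Surjective (listClass hmem) := by
  rintro ⟨R, hR⟩
  obtain ⟨Q, hQ⟩ := (bijective_reducedForms d).2 (Quotient.mk _ ⟨R, hR.1⟩)
  obtain ⟨τ, -, hτ⟩ := Quotient.exact hQ
  change R = Q.1.act τ at hτ
  have hα : (Q.1.act (σ Q)).act (τ⁻¹ * σ Q)⁻¹ = R := by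
    rw [← BinForm.act_mul, hτ, mul_inv_rev, inv_inv, mul_inv_cancel_left]
  have hadm := (BinForm.act_inv_mem_formsOfLevel_iff
    (BinForm.act_mem_formsOfDisc Q.2.1 (σ Q))).1 (hα.symm ▸ hR)
  let p : ListIndex N d σ := ⟨(Q, _), hadm⟩
  refine ⟨p, Quotient.sound ⟨ρ p * (τ⁻¹ * σ Q)⁻¹, mul_inv_mem_pmGamma1_iff.2 (hρ p), ?_⟩⟩
  change R = ((Q.1.act (σ Q)).act (ρ p)⁻¹).act (ρ p * (τ⁻¹ * σ Q)⁻¹)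
  rw [← BinForm.act_mul, inv_mul_cancel_left, hα]

end ListIndex

theorem proposition4p4_general (N : ℕ) (hN : 0 < N) (d : ℤ) (h3 : d ≠ -3) (h4 : d ≠ -4) :
    Finite (reducedForms d) ∧
    Function.Bijective (fun Q : reducedForms d =>
      (Quotient.mk (formSetoid ⊤ (formsOfDisc d)) ⟨Q.1, Q.2.1⟩ : FormClasses d)) ∧
    (∀ Q : reducedForms d, ∃ σ : SL(2, ℤ), (Q : BinForm).act σ ∈ formsOfLevel N d) ∧
    ∀ σ : reducedForms d → SL(2, ℤ),
      Finite (ListIndex N d σ) ∧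
      (∀ (Q : reducedForms d) (u v : ℤ),
        Int.gcd N (((Q : BinForm).act (σ Q)).eval v (-u)) = 1 →
        ∃ ρ : SL(2, ℤ), ρ 1 0 ≡ u [ZMOD N] ∧ ρ 1 1 ≡ v [ZMOD N]) ∧
      ∀ ρ : ListIndex N d σ → SL(2, ℤ),
        (∀ p : ListIndex N d σ, PmVec.mk N (ρ p 1 0) (ρ p 1 1) = p.1.2) →
        ∃ hmem : ∀ p : ListIndex N d σ,
            ((p.1.1 : BinForm).act (σ p.1.1)).act (ρ p)⁻¹ ∈ formsOfLevel N d,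
          Function.Bijective (fun p : ListIndex N d σ =>
            (Quotient.mk (formSetoid (pmGamma1 N) (formsOfLevel N d)) ⟨_, hmem p⟩ :
              ExtFormClasses N d)) := by
  refine ⟨finite_reducedForms d, bijective_reducedForms d,
    fun Q => BinForm.exists_act_mem_formsOfLevel Q.2.1 hN.ne', fun σ => ⟨?_, ?_, ?_⟩⟩
  · have := (finite_reducedForms d).to_subtype
    have := finite_pmVec hN
    exact Subtype.finite
  · intro Q u v h
    exact exists_SL2_bottom_row_modEq (Int.natCast_ne_zero.2 hN.ne')
      (BinForm.isCoprime_gcd_of_gcd_eval h)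
  · intro ρ hρ
    have hmem (p : ListIndex N d σ) :
        ((p.1.1 : BinForm).act (σ p.1.1)).act (ρ p)⁻¹ ∈ formsOfLevel N d := by
      refine (BinForm.act_inv_mem_formsOfLevel_iff (BinForm.act_mem_formsOfDisc p.1.1.2.1 _)).2 ?_
      rw [bottomRow, hρ]
      exact p.2
    exact ⟨hmem, injective_listClass h3 h4 hρ hmem, surjective_listClass hρ hmem⟩

theorem proposition4p4 (K : Type*) [Field K] [NumberField K]
    (hquad : Module.finrank ℚ K = 2) (himag : NumberField.IsTotallyComplex K)
    (hK₁ : ¬ ∃ x : K, x ^ 2 = -1) (hK₃ : ¬ ∃ x : K, x ^ 2 = -3)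
    (N : ℕ) (hN : 0 < N) (d : ℤ) (hd : d = NumberField.discr K) :
    -- the reduced forms are finitely many and represent each class of `C(d_K)` exactly once
    Finite (reducedForms d) ∧
    Function.Bijective (fun Q : reducedForms d =>
      (Quotient.mk (formSetoid ⊤ (formsOfDisc d)) ⟨Q.1, Q.2.1⟩ : FormClasses d)) ∧
    -- each of them can be moved into `𝒬_N(d_K)`
    (∀ Q : reducedForms d, ∃ σ : Matrix.SpecialLinearGroup (Fin 2) ℤ,
      (Q : BinForm).act σ ∈ formsOfLevel N d) ∧
    -- for every way of doing so, `Q' = Q(σ_Q (x, y)ᵗ)`: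
    ∀ σ : reducedForms d → Matrix.SpecialLinearGroup (Fin 2) ℤ,
      (∀ Q : reducedForms d, (Q : BinForm).act (σ Q) ∈ formsOfLevel N d) →
      Finite (ListIndex N d σ) ∧
      -- matrices `ρ` with the required bottom rows exist
      (∀ (Q : reducedForms d) (u v : ℤ),
        Int.gcd N (((Q : BinForm).act (σ Q)).eval v (-u)) = 1 →
        ∃ ρ : Matrix.SpecialLinearGroup (Fin 2) ℤ, ρ 1 0 ≡ u [ZMOD N] ∧ ρ 1 1 ≡ v [ZMOD N]) ∧
      -- and for every choice of them the forms `Q'(ρ⁻¹ (x, y)ᵗ)` lie in `𝒬_N(d_K)` and represent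
      -- each class of `C_N(d_K)` exactly once
      ∀ ρ : ListIndex N d σ → Matrix.SpecialLinearGroup (Fin 2) ℤ,
        (∀ p : ListIndex N d σ, PmVec.mk N (ρ p 1 0) (ρ p 1 1) = p.1.2) →
        ∃ hmem : ∀ p : ListIndex N d σ,
            ((p.1.1 : BinForm).act (σ p.1.1)).act (ρ p)⁻¹ ∈ formsOfLevel N d,
          Function.Bijective (fun p : ListIndex N d σ =>
            (Quotient.mk (formSetoid (pmGamma1 N) (formsOfLevel N d)) ⟨_, hmem p⟩ :
              ExtFormClasses N d)) :=
  have h := proposition4p4_general N hN d (hd ▸ discr_ne_neg_three K hquad hK₃)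
    (hd ▸ discr_ne_neg_four K hquad hK₁)
  ⟨h.1, h.2.1, h.2.2.1, fun σ _ => h.2.2.2 σ⟩
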